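/- Let $0\le q<1$, let $\mathcal H\neq\{0\}$ be a complex Hilbert space and let $S$ be a densely defined closable (possibly unbounded) operator in $\mathcal H$, with closure $\bar S$. Put $[n]_q=(1-q^n)/(1-q)$. Definitions. For a subspace $\mathcal D$ of $\mathcal H$, $S$ satisfies $(\mathcal O_{q,\mathcal D})$ if $S$ is closable, $\mathcal D$ is dense in $\mathcal H$, $\mathcal D\subset\operatorname{dom}(S^*\bar S)\cap\operatorname{dom}(\bar SS^*)$ and $S^*\bar Sf-q\bar SS^*f=f$ for all $f\in\mathcal D$. A closed subspace $\mathcal L$ reduces $S$ if $S(\mathcal L\cap\operatorname{dom}S)\subset\mathcal L$, $S(\mathcal L^\perp\cap\operatorname{dom}S)\subset\mathcal L^\perp$ and $P\operatorname{dom}S\subset\operatorname{dom}S$, where $P$ is the orthogonal projection onto $\mathcal L$; $S$ is irreducible if only $\{0\}$ and $\mathcal H$ reduce it. $S$ is bounded if $\|Sf\|\le M\|f\|$ for some $M$ and all $f\in\operatorname{dom}S$; $\|S\|$ is then the least such $M\ge 0$. A densely defined operator $A$ is hyponormal if $\operatorname{dom}A\subset\operatorname{dom}A^*$ and $\|A^*f\|\le\|Af\|$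 for $f\in\operatorname{dom}A$; it is normal if moreover $\operatorname{dom}A=\operatorname{dom}A^*$ and $\|A^*f\|=\|Af\|$ for $f\in\operatorname{dom}A$; it is subnormal if $A\subset N$ for a normal operator $N$ in a Hilbert space $\mathcal K$ containing $\mathcal H$ isometrically. Consider the conditions (i) there is an orthonormal basis $(e_n)_{n=0}^\infty$ of $\mathcal H$ contained in $\operatorname{dom}S$ such that $Se_n=\sqrt{[n+1]_q}\,e_{n+1}$ for $n=0,1,\dots$; (ii) $S$ is irreducible, satisfies $(\mathcal O_{q,\mathcal D})$ with some dense $\mathcal D$, is bounded, and $\|S\|=(1-q)^{-1/2}$; (iii) $S$ is irreducible, satisfies $(\mathcal O_{q,\mathcal D})$ with some dense $\mathcal D$, is bounded, and $\|S\|\le(1-q)^{-1/2}$; (iv) $S$ is irreducible, satisfies $(\mathcal O_{q,\mathcal D})$ with some dense $\mathcal D$, and is bounded; (v) $S$ is irreducible, satisfies $(\mathcal O_{q,\mathcal D})$ with some dense $\mathcal D$, and is subnormal; (vi) $S$ is irreducible, satisfies $(\mathcal O_{q,\mathcal D})$ with some dense $\mathcal D$, and is hyponormal. Then: if $S$ is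 closed and $\dim\mathcal H\ge 2$, all six conditions (i)–(vi) are equivalent. Without these two assumptions, (i) still implies (ii), and (ii)–(vi) are equivalent. -/

import Mathlib

open scoped LinearPMap

universe u

noncomputable section

namespace QOscillator

variable {H : Type u} [NormedAddCommGroup H] [InnerProductSpace ℂ H] [CompleteSpace H]

/-- The `q`-number `[n]_q`. -/
def qNumber (q : ℝ) (n : ℕ) : ℝ :=
  if q = 1 then (n : ℝ) else (1 - q ^ n) / (1 - q)

/-- The relation `S^* S - q S S^* = I` on a dense subspace `D`: the operator `S` is closable, `D` is
dense, `D` is contained in the domains of `S^* S̄` and of `S̄ S^*`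
(with `S̄` the closure of `S`), and `S^* S̄ f - q S̄ S^* f = f` for all `f ∈ D`. -/
structure SatisfiesOn (q : ℝ) (S : H →ₗ.[ℂ] H) (D : Submodule ℂ H) : Prop where
  closable : S.IsClosable
  dense : Dense (D : Set H)
  relation : ∀ f ∈ D,
    ∃ (h₁ : f ∈ S.closure.domain) (h₂ : S.closure ⟨f, h₁⟩ ∈ S†.domain)
      (h₃ : f ∈ S†.domain) (h₄ : S† ⟨f, h₃⟩ ∈ S.closure.domain),
      S† ⟨S.closure ⟨f, h₁⟩, h₂⟩ - (q : ℂ) • S.closure ⟨S† ⟨f, h₃⟩, h₄⟩ = f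

/-- `A` is bounded (on its domain, which need not be the whole space). -/
def IsBoundedOp (A : H →ₗ.[ℂ] H) : Prop :=
  ∃ M : ℝ, ∀ x : A.domain, ‖A x‖ ≤ M * ‖(x : H)‖

/-- The norm of a bounded operator: the least `c ≥ 0` with `‖A x‖ ≤ c ‖x‖` on the domain.
It is meaningful only if `A` is bounded. -/
def opNorm (A : H →ₗ.[ℂ] H) : ℝ :=
  sInf {c : ℝ | 0 ≤ c ∧ ∀ x : A.domain, ‖A x‖ ≤ c * ‖(x : H)‖}

/-- The subspace `L` is invariant for `A`: `A (L ∩ dom A) ⊆ L`. -/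
def IsInvariant (A : H →ₗ.[ℂ] H) (L : Submodule ℂ H) : Prop :=
  ∀ x : A.domain, (x : H) ∈ L → A x ∈ L

/-- The closed subspace `L` reduces `A`: both `L` and its orthogonal complement are invariant for
`A`, and the orthogonal projection onto `L` maps the domain of `A` into itself. -/
structure Reduces (L : ClosedSubmodule ℂ H) (A : H →ₗ.[ℂ] H) : Prop where
  invariant : IsInvariant A L.toSubmodule
  invariant_orthogonal : IsInvariant A (L.toSubmodule)ᗮ
  domain : ∀ x ∈ A.domain, L.toSubmodule.starProjection x ∈ A.domain

/-- `A` is irreducible: only the zero subspace and the whole space reduce it. -/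
def IsIrreducible (A : H →ₗ.[ℂ] H) : Prop :=
  ∀ L : ClosedSubmodule ℂ H, Reduces L A → L.toSubmodule = ⊥ ∨ L.toSubmodule = ⊤

/-- `A` is hyponormal: densely defined, `dom A ⊆ dom A^*`, and `‖A^* f‖ ≤ ‖A f‖` on `dom A`. -/
structure IsHyponormal (A : H →ₗ.[ℂ] H) : Prop where
  dense : Dense (A.domain : Set H)
  norm_adjoint_le : ∀ f : A.domain, ∃ h : (f : H) ∈ A†.domain, ‖A† ⟨f, h⟩‖ ≤ ‖A f‖

/-- `N` is formally normal: hyponormal with `‖N f‖ = ‖N^* f‖` on `dom N`. -/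
structure IsFormallyNormal (N : H →ₗ.[ℂ] H) : Prop extends IsHyponormal N where
  norm_adjoint_eq : ∀ (f : N.domain) (h : (f : H) ∈ N†.domain), ‖N f‖ = ‖N† ⟨f, h⟩‖

/-- `N` is normal: formally normal with `dom N = dom N^*`. -/
structure IsNormalOp (N : H →ₗ.[ℂ] H) : Prop extends IsFormallyNormal N where
  domain_eq : N.domain = N†.domain

/-- `S` is subnormal: it is densely defined and is contained in a normal operator `N` in some Hilbert
space `K` that contains `H` isometrically (through `V`). -/
def IsSubnormal (S : H →ₗ.[ℂ] H) : Prop :=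
  Dense (S.domain : Set H) ∧
    ∃ (K : Type u) (_ : NormedAddCommGroup K) (_ : InnerProductSpace ℂ K) (_ : CompleteSpace K)
      (V : H →ₗᵢ[ℂ] K) (N : K →ₗ.[ℂ] K), IsNormalOp N ∧
        ∀ x : S.domain, ∃ h : V x ∈ N.domain, N ⟨V x, h⟩ = V (S x)

/-- There is an orthonormal basis `(e_n)`, `n = 0, 1, …`, of `H`, contained in the domain of `S`, with
`S e_n = √[n+1]_q e_{n+1}`. -/
def IsQShift (q : ℝ) (S : H →ₗ.[ℂ] H) : Prop :=
  ∃ e : HilbertBasis ℕ ℂ H, ∀ n : ℕ, ∃ h : e n ∈ S.domain,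
    S ⟨e n, h⟩ = ((Real.sqrt (qNumber q (n + 1)) : ℝ) : ℂ) • e (n + 1)

end QOscillator

end

set_option linter.unusedSectionVars false

namespace QOscillator

open scoped InnerProductSpace
open ContinuousLinearMap (adjoint)

/-! If `S` is bounded, its closure is an everywhere defined bounded `W`, and the relation on a dense
subspace becomes W*W - qWW* = I on all of H (`QRelation`). Pairing with x gives ‖Wx‖² = ‖x‖² +
q‖W*x‖², and ‖W*‖ = ‖W‖ then forces ‖W‖² = 1/(1 - q): the norm conditions are automatic.
Hyponormality yields boundedness, because inserting ‖S*f‖ ≤ ‖S̄f‖ into the same identity gives (1 -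
q)‖S̄f‖² ≤ ‖f‖².

For subnormality, C = W*W - WW* is positive and W*C = qCW*. Hence R = √C satisfies W*R = √q RW*, and
the bidiagonal matrix with √q^k W on the diagonal and √[k+1]_q R above it is a normal extension of W
(`QRelation.exists_normal_dilation`). Conversely, compressing N* to H shows that a subnormal
operator is hyponormal.

For the shift model, a unit vector in ker W* generates an orthonormal ladder whose closed span is
invariant under W and W*, hence is H. If ker W* = 0, then W is onto, and bootstrapping lower bounds
gives ‖Wx‖² ≥ [n]_q‖x‖² for all n. In the limit W is normal; irreducible normal operators are
scalar, which dim H ≥ 2 excludes. Closedness of `S` makes its domain all of H, so that subspaces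
invariant under W and W* reduce `S`. -/

theorem inner_self_eq_ofReal {H : Type*} [NormedAddCommGroup H] [InnerProductSpace ℂ H] (x : H) :
    ⟪x, x⟫_ℂ = ((‖x‖ ^ 2 : ℝ) : ℂ) := by
  rw [inner_self_eq_norm_sq_to_K]
  norm_cast

/-! ### Bounded extensions and the norm forced by the relation. -/

section BoundedExtension

variable {H : Type u} [NormedAddCommGroup H] [InnerProductSpace ℂ H] [CompleteSpace H]

/-- The relation `W^* W - q W W^* = I` for a bounded everywhere defined operator. -/
def QRelation (q : ℝ) (W : H →L[ℂ] H) : Prop :=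
  ∀ x, adjoint W (W x) - (q : ℂ) • W (adjoint W x) = x

/-- The bounded everywhere defined operator `W` extends `S`. -/
def Extends (W : H →L[ℂ] H) (S : H →ₗ.[ℂ] H) : Prop :=
  ∀ x : S.domain, S x = W x

theorem exists_extension_of_bound {D : Submodule ℂ H} (hD : Dense (D : Set H)) (f : D →ₗ[ℂ] H)
    {M : ℝ} (hf : ∀ x, ‖f x‖ ≤ M * ‖(x : H)‖) : ∃ W : H →L[ℂ] H, ∀ x : D, f x = W x := by
  refine ⟨f.extendOfNorm D.subtype, fun x => ?_⟩
  exact (LinearMap.extendOfNorm_eq (e := D.subtype) (f := f) hD.denseRange_val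
    ⟨M, hf⟩ x).symm

theorem IsBoundedOp.exists_extends {S : H →ₗ.[ℂ] H} (hS : Dense (S.domain : Set H))
    (h : IsBoundedOp S) : ∃ W, Extends W S := by
  obtain ⟨M, hM⟩ := h
  exact exists_extension_of_bound hS S.toFun hM

theorem Extends.isBoundedOp {S : H →ₗ.[ℂ] H} {W : H →L[ℂ] H} (h : Extends W S) :
    IsBoundedOp S :=
  ⟨‖W‖, fun x => by rw [h x]; exact W.le_opNorm _⟩

/-- An element of the closure of the graph is the limit of elements of the graph, so every closed
condition on pairs `(x, S x)` passes to the closure of `S`. -/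
theorem closure_induction {S : H →ₗ.[ℂ] H} (hc : S.IsClosable) {p : H × H → Prop}
    (hp : IsClosed {z | p z}) (h : ∀ x : S.domain, p (x, S x)) (x : S.closure.domain) :
    p (x, S.closure x) := by
  have hx : ((x : H), S.closure x) ∈ S.graph.topologicalClosure := by
    rw [hc.graph_closure_eq_closure_graph]
    exact S.closure.mem_graph x
  refine closure_minimal (s := (S.graph : Set (H × H))) ?_ hp hx
  rintro ⟨a, b⟩ hab
  obtain ⟨y, hy, hy'⟩ := (LinearPMap.mem_graph_iff _).1 hab
  simp only at hy hy'
  subst hy hy'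
  exact h y

/-- A densely defined restriction of a bounded operator contained in a closed operator forces the
whole graph into the closed operator. -/
theorem mem_graph_of_dense {T : H →ₗ.[ℂ] H} (hT : T.IsClosed) {D : Set H} (hD : Dense D)
    {W : H →L[ℂ] H} (h : ∀ x ∈ D, (x, W x) ∈ T.graph) (x : H) : (x, W x) ∈ T.graph := by
  have hcl : IsClosed {x : H | (x, W x) ∈ T.graph} := by
    have hT' : IsClosed (T.graph : Set (H × H)) := hT
    exact hT'.preimage (f := fun x : H => (x, W x)) (by fun_prop)
  have : x ∈ closure D := hD x
  exact closure_minimal h hcl this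

theorem closure_eq_of_dense {S : H →ₗ.[ℂ] H} (hc : S.IsClosable) {D : Set H} (hD : Dense D)
    {W : H →L[ℂ] H} (h : ∀ x ∈ D, (x, W x) ∈ S.closure.graph) :
    S.closure = W.toLinearMap.toPMap ⊤ := by
  have key := mem_graph_of_dense hc.closure_isClosed hD h
  refine LinearPMap.ext (Submodule.ext fun x => ?_) fun x y z => ?_
  · simpa using LinearPMap.mem_domain_of_mem_graph (key x)
  · exact ((LinearPMap.mem_graph_iff' _).1 (key x)).elim fun a ha => by
      obtain ⟨h1, h2⟩ := Prod.ext_iff.1 ha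
      simp only at h1 h2
      subst h1
      exact h2

theorem Extends.closure_eq {S : H →ₗ.[ℂ] H} (hc : S.IsClosable) (hS : Dense (S.domain : Set H))
    {W : H →L[ℂ] H} (h : Extends W S) : S.closure = W.toLinearMap.toPMap ⊤ := by
  refine closure_eq_of_dense hc hS fun x hx => ?_
  have := h ⟨x, hx⟩
  simp only at this
  rw [← this]
  exact LinearPMap.le_graph_of_le S.le_closure (S.mem_graph ⟨x, hx⟩)

theorem Extends.of_closure_eq {S : H →ₗ.[ℂ] H} {W : H →L[ℂ] H}
    (h : S.closure = W.toLinearMap.toPMap ⊤) : Extends W S := by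
  intro x
  have h1 := LinearPMap.le_graph_of_le S.le_closure (S.mem_graph x)
  rw [h] at h1
  obtain ⟨y, hy, hy'⟩ := (LinearPMap.mem_graph_iff _).1 h1
  simp only at hy hy'
  rw [← hy', ← hy]
  rfl

theorem Extends.adjoint_eq {S : H →ₗ.[ℂ] H} (hS : Dense (S.domain : Set H))
    {W : H →L[ℂ] H} (h : Extends W S) : S† = (adjoint W).toLinearMap.toPMap ⊤ := by
  have : S = W.toLinearMap.toPMap S.domain := by
    refine LinearPMap.ext rfl fun x y z => ?_
    exact h ⟨x, y⟩
  rw [this]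
  exact W.toPMap_adjoint_eq_adjoint_toPMap_of_dense hS

/-- Both sides of the relation are continuous once S̄ and S* are replaced by `W` and its adjoint, so
density of D suffices. Conversely D = H is allowed, since the condition involves S̄ and S* rather
than the domain of `S`. -/
theorem Extends.exists_satisfiesOn_iff {S : H →ₗ.[ℂ] H} (hc : S.IsClosable)
    (hS : Dense (S.domain : Set H)) {W : H →L[ℂ] H} (h : Extends W S) (q : ℝ) :
    (∃ D, SatisfiesOn q S D) ↔ QRelation q W := by
  have h1 := h.closure_eq hc hS
  have h2 := h.adjoint_eq hS
  constructor
  · rintro ⟨D, hD⟩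
    have hcl : IsClosed {x | adjoint W (W x) - (q : ℂ) • W (adjoint W x) = x} :=
      isClosed_eq (by fun_prop) (by fun_prop)
    refine fun x => closure_minimal (s := (D : Set H)) (fun f hf => ?_) hcl (hD.dense x)
    have := hD.relation f hf
    rw [h1, h2] at this
    obtain ⟨_, _, _, _, h⟩ := this
    exact h
  · intro hW
    refine ⟨⊤, hc, by simp, fun f _ => ?_⟩
    rw [h1, h2]
    exact ⟨trivial, trivial, trivial, trivial, hW f⟩

theorem Extends.opNorm_eq {S : H →ₗ.[ℂ] H}
    (hS : Dense (S.domain : Set H)) {W : H →L[ℂ] H} (h : Extends W S) :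
    opNorm S = ‖W‖ := by
  have : {c : ℝ | 0 ≤ c ∧ ∀ x : S.domain, ‖S x‖ ≤ c * ‖(x : H)‖} = Set.Ici ‖W‖ := by
    ext c
    constructor
    · rintro ⟨hc0, hc⟩
      refine W.opNorm_le_bound hc0 fun x => ?_
      have hcl : IsClosed {x | ‖W x‖ ≤ c * ‖x‖} := isClosed_le (by fun_prop) (by fun_prop)
      refine closure_minimal (s := (S.domain : Set H)) (fun f hf => ?_) hcl (hS x)
      have := hc ⟨f, hf⟩
      rwa [h] at this
    · intro hc
      exact ⟨(norm_nonneg _).trans hc, fun x => by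
        rw [h]; exact W.le_of_opNorm_le hc _⟩
  rw [opNorm, this, csInf_Ici]

theorem QRelation.norm_sq {q : ℝ} {W : H →L[ℂ] H} (h : QRelation q W) (x : H) :
    ‖W x‖ ^ 2 = ‖x‖ ^ 2 + q * ‖adjoint W x‖ ^ 2 := by
  have h1 : ⟪adjoint W (W x), x⟫_ℂ = ⟪x, x⟫_ℂ + q * ⟪W (adjoint W x), x⟫_ℂ := by
    have := congrArg (fun y => ⟪y, x⟫_ℂ) (h x)
    simp only [inner_sub_left, inner_smul_left, Complex.conj_ofReal] at this
    linear_combination this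
  rw [ContinuousLinearMap.adjoint_inner_left,
    ← ContinuousLinearMap.adjoint_inner_right W (adjoint W x) x, inner_self_eq_ofReal,
    inner_self_eq_ofReal, inner_self_eq_ofReal] at h1
  exact_mod_cast h1

/-- The norm identity bounds `W` above through ‖W*‖ and bounds W* above through ‖W‖. As the two
norms agree, these give the two halves of ‖W‖² = 1 + q‖W‖². -/
theorem QRelation.norm_sq_eq [Nontrivial H] {q : ℝ} (hq0 : 0 ≤ q) (hq1 : q < 1)
    {W : H →L[ℂ] H} (h : QRelation q W) : ‖W‖ ^ 2 = (1 - q)⁻¹ := by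
  have hs : ‖adjoint W‖ = ‖W‖ := LinearIsometryEquiv.norm_map _ _
  have hA : ‖W‖ ^ 2 ≤ 1 + q * ‖W‖ ^ 2 := by
    have : ‖W‖ ≤ √(1 + q * ‖W‖ ^ 2) := by
      refine W.opNorm_le_bound (Real.sqrt_nonneg _) fun x => ?_
      refine le_of_sq_le_sq ?_ (by positivity)
      rw [mul_pow, Real.sq_sqrt (by positivity), h.norm_sq]
      have h1 : ‖adjoint W x‖ ^ 2 ≤ (‖W‖ * ‖x‖) ^ 2 := by
        gcongr
        exact hs ▸ (adjoint W).le_opNorm x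
      nlinarith [mul_le_mul_of_nonneg_left h1 hq0]
    calc ‖W‖ ^ 2 ≤ √(1 + q * ‖W‖ ^ 2) ^ 2 := by gcongr
      _ = _ := Real.sq_sqrt (by positivity)
  have hbd : ∀ x, ‖x‖ ^ 2 + q * ‖adjoint W x‖ ^ 2 ≤ ‖W‖ ^ 2 * ‖x‖ ^ 2 := fun x => by
    rw [← h.norm_sq, ← mul_pow]
    gcongr
    exact W.le_opNorm x
  have h1 : 1 ≤ ‖W‖ ^ 2 := by
    obtain ⟨x, hx⟩ := exists_ne (0 : H)
    have hx' : 0 < ‖x‖ ^ 2 := by positivity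
    have := hbd x
    have h3 : 0 ≤ q * ‖adjoint W x‖ ^ 2 := by positivity
    by_contra! hlt
    nlinarith
  have hB : q * ‖W‖ ^ 2 ≤ ‖W‖ ^ 2 - 1 := by
    rcases hq0.eq_or_lt with rfl | hq
    · linarith
    have : ‖adjoint W‖ ≤ √((‖W‖ ^ 2 - 1) / q) := by
      have hn : 0 ≤ (‖W‖ ^ 2 - 1) / q := div_nonneg (by linarith) hq0
      refine (adjoint W).opNorm_le_bound (Real.sqrt_nonneg _) fun x => ?_
      refine le_of_sq_le_sq ?_ (by positivity)
      rw [mul_pow, Real.sq_sqrt hn, div_mul_eq_mul_div, le_div_iff₀ hq]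
      linarith [hbd x]
    have h2 : ‖W‖ ^ 2 ≤ (‖W‖ ^ 2 - 1) / q := by
      rw [hs] at this
      calc ‖W‖ ^ 2 ≤ √((‖W‖ ^ 2 - 1) / q) ^ 2 := by gcongr
        _ = _ := Real.sq_sqrt (div_nonneg (by linarith) hq0)
    rw [le_div_iff₀ hq] at h2
    linarith
  have : 0 < 1 - q := by linarith
  field_simp
  linarith

theorem QRelation.norm_eq [Nontrivial H] {q : ℝ} (hq0 : 0 ≤ q) (hq1 : q < 1)
    {W : H →L[ℂ] H} (h : QRelation q W) : ‖W‖ = (1 - q) ^ (-(1 / 2) : ℝ) := by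
  rw [Real.rpow_neg (by linarith), ← Real.sqrt_eq_rpow, ← Real.sqrt_inv,
    ← h.norm_sq_eq hq0 hq1, Real.sqrt_sq (norm_nonneg _)]

end BoundedExtension

/-! ### Hyponormality, boundedness and compression of normal operators. -/

section Hyponormal

variable {H : Type u} [NormedAddCommGroup H] [InnerProductSpace ℂ H] [CompleteSpace H]

theorem inner_adjoint_closure {S : H →ₗ.[ℂ] H} (hc : S.IsClosable)
    (hS : Dense (S.domain : Set H)) (u : S†.domain) (x : S.closure.domain) :
    ⟪S† u, x⟫_ℂ = ⟪(u : H), S.closure x⟫_ℂ :=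
  closure_induction hc (p := fun z => ⟪S† u, z.1⟫_ℂ = ⟪(u : H), z.2⟫_ℂ)
    (isClosed_eq (by fun_prop) (by fun_prop))
    (fun y => LinearPMap.adjoint_isFormalAdjoint hS u y) x

/-- The weak form |⟨f, Sy⟩| ≤ ‖S̄f‖‖y‖ is a closed condition on (f, S̄f), so it passes from the
graph of `S` to its closure. Density then frees y, and y = S*f gives the norm inequality. -/
theorem IsHyponormal.norm_adjoint_le_closure {S : H →ₗ.[ℂ] H} (h : IsHyponormal S)
    (hc : S.IsClosable) {f : H} (h₁ : f ∈ S.closure.domain) (h₂ : f ∈ S†.domain) :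
    ‖S† ⟨f, h₂⟩‖ ≤ ‖S.closure ⟨f, h₁⟩‖ := by
  have key : ∀ y : S.domain, ‖⟪f, S y⟫_ℂ‖ ≤ ‖S.closure ⟨f, h₁⟩‖ * ‖(y : H)‖ := fun y =>
    closure_induction hc (p := fun z => ‖⟪z.1, S y⟫_ℂ‖ ≤ ‖z.2‖ * ‖(y : H)‖)
      (isClosed_le (by fun_prop) (by fun_prop))
      (fun x => by
        obtain ⟨hx, hle⟩ := h.norm_adjoint_le x
        simp only
        rw [← LinearPMap.adjoint_isFormalAdjoint h.dense ⟨x, hx⟩ y]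
        exact (norm_inner_le_norm _ _).trans (by gcongr)) ⟨f, h₁⟩
  have key2 : ∀ y : H, ‖⟪S† ⟨f, h₂⟩, y⟫_ℂ‖ ≤ ‖S.closure ⟨f, h₁⟩‖ * ‖y‖ := fun y => by
    refine closure_minimal (s := (S.domain : Set H))
      (t := {y | ‖⟪S† ⟨f, h₂⟩, y⟫_ℂ‖ ≤ ‖S.closure ⟨f, h₁⟩‖ * ‖y‖}) (fun y hy => ?_)
      (isClosed_le (by fun_prop) (by fun_prop)) (h.dense y)
    have := LinearPMap.adjoint_isFormalAdjoint h.dense ⟨f, h₂⟩ ⟨y, hy⟩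
    simp only at this
    rw [Set.mem_ofPred_eq, this]
    exact key ⟨y, hy⟩
  have := key2 (S† ⟨f, h₂⟩)
  rw [inner_self_eq_norm_sq_to_K] at this
  have h3 : ‖S† ⟨f, h₂⟩‖ * ‖S† ⟨f, h₂⟩‖ ≤ ‖S.closure ⟨f, h₁⟩‖ * ‖S† ⟨f, h₂⟩‖ := by
    simpa [sq] using this
  rcases (norm_nonneg (S† ⟨f, h₂⟩)).eq_or_lt with h0 | h0
  · rw [← h0]; exact norm_nonneg _
  · exact le_of_mul_le_mul_right h3 h0

theorem SatisfiesOn.norm_sq {q : ℝ} {S : H →ₗ.[ℂ] H} {D : Submodule ℂ H}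
    (hD : SatisfiesOn q S D) (hS : Dense (S.domain : Set H)) {f : H} (hf : f ∈ D) :
    ∃ (h₁ : f ∈ S.closure.domain) (h₂ : f ∈ S†.domain),
      ‖S.closure ⟨f, h₁⟩‖ ^ 2 = ‖f‖ ^ 2 + q * ‖S† ⟨f, h₂⟩‖ ^ 2 := by
  obtain ⟨h₁, h₂, h₃, h₄, h⟩ := hD.relation f hf
  refine ⟨h₁, h₃, ?_⟩
  have e1 := inner_adjoint_closure hD.closable hS ⟨_, h₂⟩ ⟨f, h₁⟩
  have e2 := inner_adjoint_closure hD.closable hS ⟨f, h₃⟩ ⟨_, h₄⟩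
  have e3 := congrArg (fun y => ⟪y, f⟫_ℂ) h
  simp only [inner_sub_left, inner_smul_left, Complex.conj_ofReal] at e1 e2 e3
  have e4 := congrArg (starRingEnd ℂ) e2
  rw [inner_conj_symm, inner_conj_symm] at e4
  rw [e1, ← e4] at e3
  rw [inner_self_eq_ofReal, inner_self_eq_ofReal, inner_self_eq_ofReal] at e3
  have e5 : ‖S.closure ⟨f, h₁⟩‖ ^ 2 - q * ‖S† ⟨f, h₃⟩‖ ^ 2 = ‖f‖ ^ 2 := by exact_mod_cast e3
  linarith

theorem IsHyponormal.isBoundedOp {q : ℝ} (hq0 : 0 ≤ q) (hq1 : q < 1) {S : H →ₗ.[ℂ] H}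
    (h : IsHyponormal S) {D : Submodule ℂ H} (hD : SatisfiesOn q S D) : IsBoundedOp S := by
  have hle : D ≤ S.closure.domain := fun f hf => (hD.norm_sq h.dense hf).1
  have hbound : ∀ x : D, ‖(S.closure.toFun ∘ₗ Submodule.inclusion hle) x‖ ≤
      √(1 - q)⁻¹ * ‖(x : H)‖ := by
    intro x
    obtain ⟨h₁, h₂, hx⟩ := hD.norm_sq h.dense x.2
    have hn := h.norm_adjoint_le_closure hD.closable h₁ h₂
    change ‖S.closure ⟨x, h₁⟩‖ ≤ _
    have hpos : 0 < 1 - q := by linarith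
    refine le_of_sq_le_sq ?_ (by positivity)
    rw [mul_pow, Real.sq_sqrt (by positivity), inv_mul_eq_div, le_div_iff₀ hpos]
    have : ‖S† ⟨x, h₂⟩‖ ^ 2 ≤ ‖S.closure ⟨x, h₁⟩‖ ^ 2 := by gcongr
    nlinarith [mul_le_mul_of_nonneg_left this hq0]
  -- The bound is known only on D, which need not lie in the domain of `S`. The extension from D
  -- still has its graph in the closed operator S̄, hence equals S̄.
  obtain ⟨W, hW⟩ := exists_extension_of_bound hD.dense _ hbound
  refine (Extends.of_closure_eq (W := W) (closure_eq_of_dense hD.closable hD.dense ?_)).isBoundedOp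
  intro x hx
  have := hW ⟨x, hx⟩
  simp only at this
  rw [← this]
  exact S.closure.mem_graph ⟨x, hle hx⟩

theorem IsSubnormal.isHyponormal {S : H →ₗ.[ℂ] H} (h : IsSubnormal S) : IsHyponormal S := by
  obtain ⟨hd, K, _, _, _, V, N, hN, hS⟩ := h
  refine ⟨hd, fun f => ?_⟩
  obtain ⟨hf, hf'⟩ := hS f
  obtain ⟨hf2, hle⟩ := hN.norm_adjoint_le ⟨V f, hf⟩
  set w := adjoint V.toContinuousLinearMap (N† ⟨V f, hf2⟩) with hw
  have key : ∀ x : S.domain, ⟪w, (x : H)⟫_ℂ = ⟪(f : H), S x⟫_ℂ := by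
    intro x
    obtain ⟨hx, hx'⟩ := hS x
    rw [hw, ContinuousLinearMap.adjoint_inner_left]
    have := LinearPMap.adjoint_isFormalAdjoint hN.dense ⟨V f, hf2⟩ ⟨V x, hx⟩
    rw [hx'] at this
    simpa using this
  have hmem := LinearPMap.mem_adjoint_domain_of_exists (f : H) ⟨w, key⟩
  refine ⟨hmem, ?_⟩
  rw [LinearPMap.adjoint_apply_eq hd ⟨f, hmem⟩ key]
  calc ‖w‖ ≤ ‖adjoint V.toContinuousLinearMap‖ * ‖N† ⟨V f, hf2⟩‖ :=
        ContinuousLinearMap.le_opNorm _ _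
    _ ≤ 1 * ‖N† ⟨V f, hf2⟩‖ := by
        gcongr
        rw [LinearIsometryEquiv.norm_map]
        exact V.norm_toContinuousLinearMap_le
    _ ≤ ‖S f‖ := by
        rw [one_mul]
        refine hle.trans ?_
        rw [hf', V.norm_map]

end Hyponormal

/-! ### Intertwining and the continuous functional calculus. -/

section Intertwining

variable {A : Type*} [CStarAlgebra A]

theorem norm_aeval_sub_cfc_le {f : ℝ → ℝ} (hf : Continuous f) {a : A} (ha : IsSelfAdjoint a)
    {M ε : ℝ} (hM : ‖a‖ * ‖(1 : A)‖ ≤ M) (hε : 0 ≤ ε) {p : Polynomial ℝ}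
    (hp : ∀ x ∈ Set.Icc (-M) M, |p.eval x - f x| < ε) :
    ‖Polynomial.aeval a p - cfc f a‖ ≤ ε := by
  rw [← cfc_polynomial p a ha, ← cfc_sub (fun x => p.eval x) f a (by fun_prop) (by fun_prop)]
  refine norm_cfc_le hε fun x hx => ?_
  have hx' : ‖x‖ ≤ M := (spectrum.norm_le_norm_mul_of_mem hx).trans hM
  rw [Real.norm_eq_abs, abs_le] at hx'
  exact (hp x hx').le

theorem SemiconjBy.polynomial_aeval {a b c : A} (h : SemiconjBy c a b) (p : Polynomial ℝ) :
    SemiconjBy c (Polynomial.aeval a p) (Polynomial.aeval b p) := by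
  induction p using Polynomial.induction_on' with
  | add p q hp hq => simpa using hp.add_right hq
  | monomial n r =>
    simp only [Polynomial.aeval_monomial, Algebra.algebraMap_eq_smul_one, smul_mul_assoc, one_mul]
    exact (h.pow_right n).smul_right r

/-- An element intertwining two selfadjoint elements intertwines the values of the continuous
functional calculus. -/
theorem SemiconjBy.cfc_real {a b c : A} (h : SemiconjBy c a b) (ha : IsSelfAdjoint a)
    (hb : IsSelfAdjoint b) {f : ℝ → ℝ} (hf : Continuous f) :
    SemiconjBy c (cfc f a) (cfc f b) := by
  -- A single interval containing both spectra, so that one polynomial approximates `f` for `a` and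
  -- for `b`.
  set M := max (‖a‖ * ‖(1 : A)‖) (‖b‖ * ‖(1 : A)‖)
  have key : ∀ ε > 0, ‖c * cfc f a - cfc f b * c‖ ≤ ε * (2 * ‖c‖) := by
    intro ε hε
    obtain ⟨p, hp⟩ := exists_polynomial_near_of_continuousOn (-M) M f hf.continuousOn ε hε
    have h1 := norm_aeval_sub_cfc_le hf ha (le_max_left _ _) hε.le hp
    have h2 := norm_aeval_sub_cfc_le hf hb (le_max_right _ _) hε.le hp
    have h3 : c * cfc f a - cfc f b * c = (Polynomial.aeval b p - cfc f b) * c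
        - c * (Polynomial.aeval a p - cfc f a) := by
      rw [sub_mul, mul_sub, (SemiconjBy.polynomial_aeval h p).eq]
      abel
    rw [h3]
    calc _ ≤ ‖(Polynomial.aeval b p - cfc f b) * c‖
          + ‖c * (Polynomial.aeval a p - cfc f a)‖ := norm_sub_le _ _
      _ ≤ ε * ‖c‖ + ‖c‖ * ε := by
        gcongr
        · exact (norm_mul_le _ _).trans (by gcongr)
        · exact (norm_mul_le _ _).trans (by gcongr)
      _ = _ := by ring
  have h0 : ‖c * cfc f a - cfc f b * c‖ ≤ 0 := by
    refine le_of_forall_pos_le_add fun δ hδ => ?_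
    refine (key (δ / (2 * ‖c‖ + 1)) (by positivity)).trans ?_
    rw [zero_add, div_mul_eq_mul_div, div_le_iff₀ (by positivity)]
    nlinarith
  exact sub_eq_zero.1 (norm_le_zero_iff.1 h0)

end Intertwining

/-! ### Shifts and bidiagonal operator matrices on a countable direct sum. -/

noncomputable section BlockOperator

variable {H : Type u} [NormedAddCommGroup H] [InnerProductSpace ℂ H]

/-- The Hilbert space `⊕_{n ≥ 0} H`. -/
abbrev SeqSpace (H : Type u) [NormedAddCommGroup H] : Type u := lp (fun _ : ℕ => H) 2

theorem memlp_succ (f : SeqSpace H) : Memℓp (fun k => f (k + 1)) 2 := by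
  have h := (lp.memℓp f).summable (by norm_num)
  exact memℓp_gen ((summable_nat_add_iff 1).2 h)

theorem memlp_cases (f : SeqSpace H) :
    Memℓp (fun k => Nat.casesOn (motive := fun _ => H) k 0 f) 2 := by
  have h := (lp.memℓp f).summable (by norm_num)
  exact memℓp_gen ((summable_nat_add_iff 1).1 h)

theorem seqSpace_ext {f g : SeqSpace H} (h : ∀ k, f k = g k) : f = g :=
  lp.ext (funext h)

theorem seqSpace_norm_sq (f : SeqSpace H) : HasSum (fun k => ‖f k‖ ^ 2) (‖f‖ ^ 2) := by
  simpa using lp.hasSum_norm (p := 2) (by norm_num) f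

/-- The backward shift. -/
def backwardShift : SeqSpace H →L[ℂ] SeqSpace H :=
  LinearMap.mkContinuous
    { toFun f := ⟨fun k => f (k + 1), memlp_succ f⟩
      map_add' _ _ := seqSpace_ext fun _ => rfl
      map_smul' _ _ := seqSpace_ext fun _ => rfl } 1 fun f => by
    rw [one_mul]
    refine le_of_sq_le_sq ?_ (norm_nonneg _)
    have h1 := seqSpace_norm_sq f
    have h2 := (hasSum_nat_add_iff' 1).2 h1
    refine ((seqSpace_norm_sq (⟨fun k => f (k + 1), memlp_succ f⟩ : SeqSpace H)).unique
      h2).trans_le ?_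
    simp

/-- The forward shift. -/
def forwardShift : SeqSpace H →L[ℂ] SeqSpace H :=
  LinearMap.mkContinuous
    { toFun f := ⟨fun k => Nat.casesOn (motive := fun _ => H) k 0 f, memlp_cases f⟩
      map_add' _ _ := seqSpace_ext fun k => by
        cases k
        · exact (add_zero (0 : H)).symm
        · rfl
      map_smul' c _ := seqSpace_ext fun k => by
        cases k
        · exact (smul_zero (A := H) c).symm
        · rfl } 1 fun f => by
    rw [one_mul]
    refine le_of_sq_le_sq ?_ (norm_nonneg _)
    have h1 := seqSpace_norm_sq
      (⟨fun k => Nat.casesOn (motive := fun _ => H) k 0 f, memlp_cases f⟩ : SeqSpace H)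
    have h2 := (hasSum_nat_add_iff' 1).2 h1
    refine le_of_eq ?_
    simpa using h2.unique (seqSpace_norm_sq f)

@[simp]
theorem forwardShift_zero (f : SeqSpace H) : forwardShift f 0 = 0 := rfl

variable [CompleteSpace H]

theorem inner_forwardShift (f g : SeqSpace H) :
    ⟪forwardShift f, g⟫_ℂ = ⟪f, backwardShift g⟫_ℂ := by
  rw [lp.inner_eq_tsum, lp.inner_eq_tsum, (lp.summable_inner (𝕜 := ℂ) _ _).tsum_eq_zero_add,
    forwardShift_zero, inner_zero_left, zero_add]
  rfl

theorem adjoint_backwardShift : adjoint (backwardShift (H := H)) = forwardShift :=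
  ((ContinuousLinearMap.eq_adjoint_iff _ _).2 inner_forwardShift).symm

theorem adjoint_mapCLM {T : ℕ → H →L[ℂ] H} {K : ℝ} (hK : 0 ≤ K) (hT : ∀ k, ‖T k‖ ≤ K)
    (hT' : ∀ k, ‖adjoint (T k)‖ ≤ K) :
    adjoint (lp.mapCLM 2 T hK hT) = lp.mapCLM 2 (fun k => adjoint (T k)) hK hT' := by
  refine ((ContinuousLinearMap.eq_adjoint_iff _ _).2 fun f g => ?_).symm
  rw [lp.inner_eq_tsum, lp.inner_eq_tsum]
  exact tsum_congr fun k => ContinuousLinearMap.adjoint_inner_left (T k) _ _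

/-- A bounded upper bidiagonal operator matrix `(A k)`, `(B k)` is normal if its entries satisfy the
relations obtained by comparing matrix entries. -/
theorem exists_normal_bidiagonal {A B : ℕ → H →L[ℂ] H} {K : ℝ} (hK : 0 ≤ K)
    (hA : ∀ k, ‖A k‖ ≤ K) (hB : ∀ k, ‖B k‖ ≤ K)
    (h1 : ∀ k, star (A k) * B k = B k * star (A (k + 1)))
    (h2 : star (A 0) * A 0 = A 0 * star (A 0) + B 0 * star (B 0))
    (h3 : ∀ k, star (A (k + 1)) * A (k + 1) + star (B k) * B k =
      A (k + 1) * star (A (k + 1)) + B (k + 1) * star (B (k + 1))) :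
    ∃ N : SeqSpace H →L[ℂ] SeqSpace H, IsStarNormal N ∧
      ∀ x, N (lp.single 2 0 x) = lp.single 2 0 (A 0 x) := by
  have hA' : ∀ k, ‖adjoint (A k)‖ ≤ K := fun k => by
    rw [LinearIsometryEquiv.norm_map]; exact hA k
  have hB' : ∀ k, ‖adjoint (B k)‖ ≤ K := fun k => by
    rw [LinearIsometryEquiv.norm_map]; exact hB k
  have h1' : ∀ k, star (B k) * A k = A (k + 1) * star (B k) := fun k => by
    simpa using congrArg star (h1 k)
  simp only [ContinuousLinearMap.star_eq_adjoint] at h1 h2 h3 h1'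
  have e1 : ∀ k x, adjoint (A k) (B k x) = B k (adjoint (A (k + 1)) x) := fun k x =>
    DFunLike.congr_fun (h1 k) x
  have e1' : ∀ k x, adjoint (B k) (A k x) = A (k + 1) (adjoint (B k) x) := fun k x =>
    DFunLike.congr_fun (h1' k) x
  have e2 : ∀ x, adjoint (A 0) (A 0 x) = A 0 (adjoint (A 0) x) + B 0 (adjoint (B 0) x) :=
    fun x => DFunLike.congr_fun h2 x
  have e3 : ∀ k x, adjoint (A (k + 1)) (A (k + 1) x) + adjoint (B k) (B k x) =
      A (k + 1) (adjoint (A (k + 1)) x) + B (k + 1) (adjoint (B (k + 1)) x) := fun k x =>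
    DFunLike.congr_fun (h3 k) x
  refine ⟨lp.mapCLM 2 A hK hA + lp.mapCLM 2 B hK hB ∘L backwardShift, ?_, fun x => ?_⟩
  · rw [isStarNormal_iff, ContinuousLinearMap.star_eq_adjoint, map_add,
      ContinuousLinearMap.adjoint_comp, adjoint_backwardShift, adjoint_mapCLM hK hA hA',
      adjoint_mapCLM hK hB hB']
    refine ContinuousLinearMap.ext fun f => seqSpace_ext fun k => ?_
    -- Normality is compared coordinatewise. Row 0 is separate because no entry of B enters it from
    -- the preceding row.
    cases k with
    | zero =>
      change adjoint (A 0) (A 0 (f 0) + B 0 (f 1)) + 0 =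
        A 0 (adjoint (A 0) (f 0) + 0) + B 0 (adjoint (A 1) (f 1) + adjoint (B 0) (f 0))
      simp only [map_add, e1, e2, add_zero]
      abel
    | succ k =>
      change adjoint (A (k + 1)) (A (k + 1) (f (k + 1)) + B (k + 1) (f (k + 2))) +
          adjoint (B k) (A k (f k) + B k (f (k + 1))) =
        A (k + 1) (adjoint (A (k + 1)) (f (k + 1)) + adjoint (B k) (f k)) +
          B (k + 1) (adjoint (A (k + 2)) (f (k + 2)) + adjoint (B (k + 1)) (f (k + 1)))
      simp only [map_add, e1, e1']
      rw [← sub_eq_zero, ← sub_eq_zero.2 (e3 k (f (k + 1)))]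
      abel
  · refine seqSpace_ext fun k => ?_
    change A k (lp.single (E := fun _ : ℕ => H) 2 0 x k) +
      B k (lp.single (E := fun _ : ℕ => H) 2 0 x (k + 1)) =
      lp.single (E := fun _ : ℕ => H) 2 0 (A 0 x) k
    rw [lp.single_apply_ne _ _ _ k.succ_ne_zero, map_zero, add_zero]
    cases k with
    | zero => rw [lp.single_apply_self, lp.single_apply_self]
    | succ k =>
      rw [lp.single_apply_ne _ _ _ k.succ_ne_zero, lp.single_apply_ne _ _ _ k.succ_ne_zero,
        map_zero]

end BlockOperator

/-! ### The normal extension. -/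

noncomputable section Subnormal

variable {H : Type u} [NormedAddCommGroup H] [InnerProductSpace ℂ H] [CompleteSpace H]

theorem QRelation.operator_eq {q : ℝ} {W : H →L[ℂ] H} (h : QRelation q W) :
    star W * W = 1 + (q : ℂ) • (W * star W) := by
  ext x
  have := h x
  rw [sub_eq_iff_eq_add] at this
  exact this

/-- Expanding w*w in w*(w*w) and in (w*w)w* leaves a summand w* in each; it cancels in the
difference, and q factors out. -/
theorem semiconjBy_star_commutator {A : Type*} [CStarAlgebra A] {q : ℂ} {w : A}
    (h : star w * w = 1 + q • (w * star w)) :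
    SemiconjBy (star w) (star w * w - w * star w) (q • (star w * w - w * star w)) := by
  have h1 : star w * (star w * w) = star w + q • (star w * w * star w) := by
    conv_lhs => rw [h]
    rw [mul_add, mul_smul_comm, mul_one, mul_assoc]
  have h2 : star w * w * star w = star w + q • (w * star w * star w) := by
    conv_lhs => rw [h]
    rw [add_mul, smul_mul_assoc, one_mul]
  rw [SemiconjBy, mul_sub, h1, ← mul_assoc, smul_mul_assoc, sub_mul]
  calc _ = q • (star w * w * star w) + (star w - star w * w * star w) := by abel
    _ = q • (star w * w * star w) - q • (w * star w * star w) := by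
      nth_rw 2 [h2]
      abel
    _ = _ := (smul_sub _ _ _).symm

theorem QRelation.norm_adjoint_le {q : ℝ} (hq0 : 0 ≤ q) (hq1 : q < 1) {W : H →L[ℂ] H}
    (h : QRelation q W) (x : H) : ‖adjoint W x‖ ≤ ‖W x‖ := by
  cases subsingleton_or_nontrivial H
  · simp [Subsingleton.elim x 0]
  have h1 : ‖adjoint W x‖ ^ 2 ≤ (1 - q)⁻¹ * ‖x‖ ^ 2 := by
    rw [← h.norm_sq_eq hq0 hq1, ← mul_pow, ← LinearIsometryEquiv.norm_map adjoint W]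
    gcongr
    exact (adjoint W).le_opNorm x
  have hpos : 0 < 1 - q := by linarith
  rw [inv_mul_eq_div, le_div_iff₀ hpos] at h1
  refine le_of_sq_le_sq ?_ (norm_nonneg _)
  rw [h.norm_sq]
  linarith

theorem QRelation.commutator_nonneg {q : ℝ} (hq0 : 0 ≤ q) (hq1 : q < 1) {W : H →L[ℂ] H}
    (h : QRelation q W) : 0 ≤ star W * W - W * star W := by
  rw [ContinuousLinearMap.nonneg_iff_isPositive, ContinuousLinearMap.isPositive_def]
  refine ⟨?_, fun x => ?_⟩
  · exact ((IsSelfAdjoint.star_mul_self W).sub (IsSelfAdjoint.mul_star_self W)).isSymmetric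
  · have e1 : ⟪adjoint W (W x), x⟫_ℂ = ((‖W x‖ ^ 2 : ℝ) : ℂ) := by
      rw [ContinuousLinearMap.adjoint_inner_left, inner_self_eq_ofReal]
    have e2 : ⟪W (adjoint W x), x⟫_ℂ = ((‖adjoint W x‖ ^ 2 : ℝ) : ℂ) := by
      rw [← ContinuousLinearMap.adjoint_inner_right W (adjoint W x) x, inner_self_eq_ofReal]
    have : (star W * W - W * star W).reApplyInnerSelf x = ‖W x‖ ^ 2 - ‖adjoint W x‖ ^ 2 := by
      change RCLike.re ⟪adjoint W (W x) - W (adjoint W x), x⟫_ℂ = _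
      rw [inner_sub_left, e1, e2, ← Complex.ofReal_sub]
      exact Complex.ofReal_re _
    rw [this, sub_nonneg]
    have := h.norm_adjoint_le hq0 hq1 x
    gcongr

theorem isNormalOp_toPMap {K : Type*} [NormedAddCommGroup K] [InnerProductSpace ℂ K]
    [CompleteSpace K] {N : K →L[ℂ] K} (hN : IsStarNormal N) :
    IsNormalOp (N.toLinearMap.toPMap ⊤) := by
  have hd : Dense (((⊤ : Submodule ℂ K)) : Set K) := by simp
  have hadj := N.toPMap_adjoint_eq_adjoint_toPMap_of_dense hd
  have hnorm := ContinuousLinearMap.isStarNormal_iff_norm_eq_adjoint.1 hN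
  refine ⟨⟨⟨hd, fun f => ?_⟩, fun f => ?_⟩, ?_⟩
  · rw [hadj]
    exact ⟨trivial, (hnorm f).ge⟩
  · rw [hadj]
    exact fun _ => hnorm f
  · rw [hadj]
    rfl

theorem qNumber_nonneg {q : ℝ} (hq0 : 0 ≤ q) (hq1 : q < 1) (n : ℕ) : 0 ≤ qNumber q n := by
  rw [qNumber, if_neg hq1.ne]
  exact div_nonneg (sub_nonneg.2 (pow_le_one₀ hq0 hq1.le)) (by linarith)

theorem qNumber_succ {q : ℝ} (hq1 : q < 1) (n : ℕ) : qNumber q (n + 1) = qNumber q n + q ^ n := by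
  have : 1 - q ≠ 0 := by linarith
  rw [qNumber, if_neg hq1.ne, qNumber, if_neg hq1.ne]
  field_simp
  ring

theorem qNumber_succ' {q : ℝ} (hq1 : q < 1) (n : ℕ) : qNumber q (n + 1) = 1 + q * qNumber q n := by
  have : 1 - q ≠ 0 := by linarith
  rw [qNumber, if_neg hq1.ne, qNumber, if_neg hq1.ne]
  field_simp
  ring

theorem qNumber_zero {q : ℝ} (hq1 : q < 1) : qNumber q 0 = 0 := by
  simp [qNumber, hq1.ne]

theorem qNumber_le {q : ℝ} (hq0 : 0 ≤ q) (hq1 : q < 1) (n : ℕ) : qNumber q n ≤ (1 - q)⁻¹ := by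
  rw [qNumber, if_neg hq1.ne, inv_eq_one_div]
  have : 0 < 1 - q := by linarith
  gcongr
  linarith [pow_nonneg hq0 n]

/-- The positive square root `R` of the selfcommutator intertwines `W^*` with `√q W^*`. -/
theorem QRelation.exists_sqrt_commutator {q : ℝ} (hq0 : 0 ≤ q) (hq1 : q < 1) {W : H →L[ℂ] H}
    (h : QRelation q W) : ∃ R : H →L[ℂ] H, star R = R ∧ R * R = star W * W - W * star W ∧
      star W * R = √q • (R * star W) := by
  have hC := h.commutator_nonneg hq0 hq1
  set C := star W * W - W * star W with hCdef
  have hCs : IsSelfAdjoint C := hC.isSelfAdjoint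
  refine ⟨cfc Real.sqrt C, cfc_predicate (R := ℝ) _ C, ?_, ?_⟩
  · rw [← cfc_mul Real.sqrt Real.sqrt C (by fun_prop) (by fun_prop)]
    conv_rhs => rw [← cfc_id' ℝ C]
    exact cfc_congr fun x hx => Real.mul_self_sqrt (spectrum_nonneg_of_nonneg hC hx)
  · have h1 : SemiconjBy (star W) C (q • C) := by
      have := semiconjBy_star_commutator h.operator_eq
      rwa [Complex.coe_smul] at this
    have hqC : IsSelfAdjoint (q • C) := by
      rw [IsSelfAdjoint, star_smul, star_trivial, hCs.star_eq]
    have h2 := SemiconjBy.cfc_real h1 hCs hqC Real.continuous_sqrt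
    have h3 : cfc Real.sqrt (q • C) = √q • cfc Real.sqrt C := by
      rw [← cfc_comp_smul q Real.sqrt C (by fun_prop), ← cfc_smul _ _ _ (by fun_prop)]
      -- Only q ≥ 0 is needed here: the real square root vanishes on negative numbers, so √(qx) = √q
      -- √x for every x.
      exact cfc_congr fun x _ => Real.sqrt_mul hq0 x
    rw [h3] at h2
    rw [h2.eq, smul_mul_assoc]

/-- Powers of √q on the diagonal absorb the factor in W*R = √q RW*. With C = W*W - WW*, the diagonal
entries then require q^(k+1) C + [k+1]_q C = [k+2]_q C, which is the recursion for the q-numbers. -/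
theorem QRelation.exists_normal_dilation {q : ℝ} (hq0 : 0 ≤ q) (hq1 : q < 1) {W : H →L[ℂ] H}
    (h : QRelation q W) : ∃ N : SeqSpace H →L[ℂ] SeqSpace H, IsStarNormal N ∧
      ∀ x, N (lp.single 2 0 x) = lp.single 2 0 (W x) := by
  obtain ⟨R, hR, hRR, hWR⟩ := h.exists_sqrt_commutator hq0 hq1
  have hsq : √q ≤ 1 := Real.sqrt_le_one.2 hq1.le
  have hnum := fun n => Real.mul_self_sqrt (qNumber_nonneg hq0 hq1 n)
  set A : ℕ → H →L[ℂ] H := fun k => (√q ^ k) • W with hA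
  set B : ℕ → H →L[ℂ] H := fun k => √(qNumber q (k + 1)) • R with hB
  have hK : 0 ≤ max ‖W‖ (√(1 - q)⁻¹ * ‖R‖) := le_max_of_le_left (norm_nonneg _)
  have bA : ∀ k, ‖A k‖ ≤ max ‖W‖ (√(1 - q)⁻¹ * ‖R‖) := fun k => by
    refine le_max_of_le_left ?_
    rw [hA, norm_smul, Real.norm_of_nonneg (by positivity)]
    exact mul_le_of_le_one_left (norm_nonneg _) (pow_le_one₀ (by positivity) hsq)
  have bB : ∀ k, ‖B k‖ ≤ max ‖W‖ (√(1 - q)⁻¹ * ‖R‖) := fun k => by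
    refine le_max_of_le_right ?_
    rw [hB, norm_smul, Real.norm_of_nonneg (by positivity)]
    gcongr
    exact qNumber_le hq0 hq1 _
  have c1 : ∀ k, star (A k) * B k = B k * star (A (k + 1)) := fun k => by
    simp only [hA, hB, star_smul, star_trivial, smul_mul_smul_comm, hWR, smul_smul]
    congr 1
    ring
  have c2 : star (A 0) * A 0 = A 0 * star (A 0) + B 0 * star (B 0) := by
    simp only [hA, hB, star_smul, star_trivial, smul_mul_smul_comm, hR, hRR]
    rw [hnum, qNumber_succ hq1, qNumber_zero hq1]
    simp
  have c3 : ∀ k, star (A (k + 1)) * A (k + 1) + star (B k) * B k =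
      A (k + 1) * star (A (k + 1)) + B (k + 1) * star (B (k + 1)) := fun k => by
    simp only [hA, hB, star_smul, star_trivial, smul_mul_smul_comm, hR, hRR]
    rw [hnum, hnum, qNumber_succ hq1 (k + 1), ← mul_pow, Real.mul_self_sqrt hq0]
    module
  obtain ⟨N, hN, hNW⟩ := exists_normal_bidiagonal hK bA bB c1 c2 c3
  refine ⟨N, hN, fun x => ?_⟩
  rw [hNW, hA]
  simp

/-- The embedding of `H` as the zeroth summand of `⊕_{n ≥ 0} H`. -/
def zerothEmbedding (H : Type u) [NormedAddCommGroup H] [InnerProductSpace ℂ H] :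
    H →ₗᵢ[ℂ] SeqSpace H where
  toFun := lp.single (E := fun _ : ℕ => H) 2 0
  map_add' x y := lp.single_add (E := fun _ : ℕ => H) 2 0 x y
  map_smul' c x := lp.single_smul (𝕜 := ℂ) (E := fun _ : ℕ => H) 2 0 c x
  norm_map' x := lp.norm_single (E := fun _ : ℕ => H) two_pos 0 x

theorem QRelation.isSubnormal {q : ℝ} (hq0 : 0 ≤ q) (hq1 : q < 1) {W : H →L[ℂ] H}
    (h : QRelation q W) {S : H →ₗ.[ℂ] H} (hS : Dense (S.domain : Set H)) (hWS : Extends W S) :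
    IsSubnormal S := by
  obtain ⟨N, hN, hNW⟩ := h.exists_normal_dilation hq0 hq1
  refine ⟨hS, SeqSpace H, inferInstance, inferInstance, inferInstance, zerothEmbedding H,
    N.toLinearMap.toPMap ⊤, isNormalOp_toPMap hN, fun x => ⟨trivial, ?_⟩⟩
  rw [hWS x]
  exact hNW x

end Subnormal

/-! ### Weighted shifts satisfy the relation and are irreducible. -/

section WeightedShift

variable {H : Type u} [NormedAddCommGroup H] [InnerProductSpace ℂ H] [CompleteSpace H]

theorem hilbertBasis_ext_inner (e : HilbertBasis ℕ ℂ H) {x y : H}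
    (h : ∀ n, ⟪e n, x⟫_ℂ = ⟪e n, y⟫_ℂ) : x = y := by
  refine e.repr.injective (lp.ext (funext fun n => ?_))
  rw [e.repr_apply_apply, e.repr_apply_apply, h]

theorem hilbertBasis_dense_span (e : HilbertBasis ℕ ℂ H) :
    Dense (Submodule.span ℂ (Set.range e) : Set H) :=
  Submodule.dense_iff_topologicalClosure_eq_top.2 e.dense_span

theorem exists_weightedShift (e : HilbertBasis ℕ ℂ H) {w : ℕ → ℝ} {K : ℝ} (hK : 0 ≤ K)
    (hw : ∀ n, |w n| ≤ K) :
    ∃ W : H →L[ℂ] H, ∀ n, W (e n) = (w n : ℂ) • e (n + 1) := by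
  have hT : ∀ n, ‖(w n : ℂ) • ContinuousLinearMap.id ℂ ℂ‖ ≤ K := fun n => by
    rw [norm_smul, ContinuousLinearMap.norm_id, mul_one, Complex.norm_real]
    exact hw n
  refine ⟨(e.repr.symm : SeqSpace ℂ →L[ℂ] H) ∘L forwardShift ∘L
    lp.mapCLM 2 (fun n => (w n : ℂ) • ContinuousLinearMap.id ℂ ℂ) hK hT ∘L
      (e.repr : H →L[ℂ] SeqSpace ℂ), fun n => ?_⟩
  have key : forwardShift (lp.mapCLM 2 (fun n => (w n : ℂ) • ContinuousLinearMap.id ℂ ℂ) hK hT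
      (lp.single (E := fun _ : ℕ => ℂ) 2 n 1)) =
      (w n : ℂ) • lp.single (E := fun _ : ℕ => ℂ) 2 (n + 1) 1 := by
    refine seqSpace_ext fun k => ?_
    rw [lp.coeFn_smul, Pi.smul_apply, lp.single_apply]
    cases k with
    | zero => simp
    | succ k =>
      change (w k : ℂ) • (lp.single (E := fun _ : ℕ => ℂ) 2 n 1 k) = _
      rw [lp.single_apply]
      rcases eq_or_ne k n with rfl | hk
      · simp
      · have hk' : k + 1 ≠ n + 1 := by omega
        rw [Pi.single_eq_of_ne hk, Pi.single_eq_of_ne hk', smul_zero, smul_zero]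
  change e.repr.symm (forwardShift (lp.mapCLM 2 _ hK hT (e.repr (e n)))) = _
  rw [e.repr_self, key, map_smul, e.repr_symm_single]

/-- The closure of `S` contains the graph of `W` over the dense span of the basis, hence all of it.
This also determines `S` on domain vectors outside that span. -/
theorem extends_of_hilbertBasis (e : HilbertBasis ℕ ℂ H) {S : H →ₗ.[ℂ] H} (hc : S.IsClosable)
    {W : H →L[ℂ] H} (h : ∀ n, ∃ hn : e n ∈ S.domain, S ⟨e n, hn⟩ = W (e n)) : Extends W S := by
  refine Extends.of_closure_eq (closure_eq_of_dense hc (hilbertBasis_dense_span e) fun x hx => ?_)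
  have hle : Submodule.span ℂ (Set.range e) ≤
      S.closure.graph.comap (LinearMap.id.prod W.toLinearMap) := by
    refine Submodule.span_le.2 ?_
    rintro _ ⟨n, rfl⟩
    obtain ⟨hn, hn'⟩ := h n
    have := LinearPMap.le_graph_of_le S.le_closure (S.mem_graph ⟨e n, hn⟩)
    rw [hn'] at this
    exact this
  exact hle hx

theorem adjoint_weightedShift_succ (e : HilbertBasis ℕ ℂ H) {w : ℕ → ℝ} {W : H →L[ℂ] H}
    (hW : ∀ n, W (e n) = (w n : ℂ) • e (n + 1)) (n : ℕ) :
    adjoint W (e (n + 1)) = (w n : ℂ) • e n := by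
  refine hilbertBasis_ext_inner e fun m => ?_
  rw [ContinuousLinearMap.adjoint_inner_right, hW, inner_smul_left, inner_smul_right,
    orthonormal_iff_ite.1 e.orthonormal, orthonormal_iff_ite.1 e.orthonormal, Complex.conj_ofReal]
  by_cases h : m = n <;> simp [h]

theorem adjoint_weightedShift_zero (e : HilbertBasis ℕ ℂ H) {w : ℕ → ℝ} {W : H →L[ℂ] H}
    (hW : ∀ n, W (e n) = (w n : ℂ) • e (n + 1)) : adjoint W (e 0) = 0 := by
  refine hilbertBasis_ext_inner e fun m => ?_
  rw [ContinuousLinearMap.adjoint_inner_right, hW, inner_smul_left,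
    orthonormal_iff_ite.1 e.orthonormal]
  simp

theorem eq_smul_of_adjoint_weightedShift_eq_zero (e : HilbertBasis ℕ ℂ H) {w : ℕ → ℝ}
    (hw : ∀ n, w n ≠ 0) {W : H →L[ℂ] H} (hW : ∀ n, W (e n) = (w n : ℂ) • e (n + 1)) {y : H}
    (hy : adjoint W y = 0) : y = ⟪e 0, y⟫_ℂ • e 0 := by
  refine hilbertBasis_ext_inner e fun m => ?_
  rw [inner_smul_right, orthonormal_iff_ite.1 e.orthonormal]
  cases m with
  | zero => simp
  | succ m =>
    have : (w m : ℂ) * ⟪e (m + 1), y⟫_ℂ = 0 := by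
      have h := ContinuousLinearMap.adjoint_inner_right W (e m) y
      rw [hy, inner_zero_right, hW, inner_smul_left, Complex.conj_ofReal] at h
      exact h.symm
    have hm : (w m : ℂ) ≠ 0 := Complex.ofReal_ne_zero.2 (hw m)
    simpa using (mul_eq_zero.1 this).resolve_left hm

theorem Reduces.starProjection_comm {S : H →ₗ.[ℂ] H} (hS : Dense (S.domain : Set H))
    {W : H →L[ℂ] H} (hWS : Extends W S) {L : ClosedSubmodule ℂ H} (h : Reduces L S) (x : H) :
    L.toSubmodule.starProjection (W x) = W (L.toSubmodule.starProjection x) := by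
  set P := L.toSubmodule.starProjection with hP
  refine closure_minimal (s := (S.domain : Set H)) (t := {x | P (W x) = W (P x)})
    (fun x hx => ?_) (isClosed_eq (by fun_prop) (by fun_prop)) (hS x)
  have hPx := h.domain x hx
  have h1 : W (P x) ∈ L.toSubmodule := by
    rw [← hWS ⟨_, hPx⟩]
    exact h.invariant ⟨_, hPx⟩ (Submodule.starProjection_apply_mem _ _)
  have hsub := S.domain.sub_mem hx hPx
  have h2 : W (x - P x) ∈ L.toSubmoduleᗮ := by
    rw [← hWS ⟨_, hsub⟩]
    exact h.invariant_orthogonal ⟨_, hsub⟩ (Submodule.sub_starProjection_mem_orthogonal _)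
  exact Submodule.eq_starProjection_of_mem_orthogonal h1 (by rwa [map_sub] at h2)

/-- A reducing projection commutes with W*, so it preserves ker W* = ℂe₀ and acts there as a scalar
c. Commuting with `W`, it acts as c on every basis vector, because no weight vanishes. -/
theorem isIrreducible_of_weightedShift (e : HilbertBasis ℕ ℂ H) {w : ℕ → ℝ}
    (hw : ∀ n, w n ≠ 0) {W : H →L[ℂ] H} (hW : ∀ n, W (e n) = (w n : ℂ) • e (n + 1))
    {S : H →ₗ.[ℂ] H} (hS : Dense (S.domain : Set H)) (hWS : Extends W S) : IsIrreducible S := by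
  intro L hL
  have hcomm := hL.starProjection_comm hS hWS
  set P := L.toSubmodule.starProjection with hP
  have hPs : adjoint P = P := isSelfAdjoint_starProjection L.toSubmodule
  have hcomm' : ∀ x, adjoint W (P x) = P (adjoint W x) := by
    have h1 : P ∘L W = W ∘L P := ContinuousLinearMap.ext hcomm
    have h2 := congrArg adjoint h1
    rw [ContinuousLinearMap.adjoint_comp, ContinuousLinearMap.adjoint_comp, hPs] at h2
    exact fun x => DFunLike.congr_fun h2 x
  have h0 := eq_smul_of_adjoint_weightedShift_eq_zero e hw hW (y := P (e 0))
    (by rw [hcomm', adjoint_weightedShift_zero e hW, map_zero])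
  set c := ⟪e 0, P (e 0)⟫_ℂ
  have hn : ∀ n, P (e n) = c • e n := by
    intro n
    induction n with
    | zero => exact h0
    | succ n ih =>
      have hm : (w n : ℂ) ≠ 0 := Complex.ofReal_ne_zero.2 (hw n)
      have := hcomm (e n)
      rw [hW, ih, map_smul, map_smul, hW, smul_comm] at this
      exact smul_right_injective H hm this
  have hPc : P = c • ContinuousLinearMap.id ℂ H := by
    refine ContinuousLinearMap.ext_on (hilbertBasis_dense_span e) ?_
    rintro _ ⟨n, rfl⟩
    exact hn n
  rcases eq_or_ne c 0 with hc | hc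
  · refine Or.inl ((Submodule.eq_bot_iff _).2 fun x hx => ?_)
    rw [← Submodule.starProjection_eq_self_iff.2 hx, ← hP, hPc, hc]
    simp
  · refine Or.inr (Submodule.eq_top_iff'.2 fun x => ?_)
    have h1 : P x ∈ L.toSubmodule := Submodule.starProjection_apply_mem _ _
    rw [hPc] at h1
    exact (Submodule.smul_mem_iff _ hc).1 h1

theorem qRelation_of_weightedShift (e : HilbertBasis ℕ ℂ H) {q : ℝ} (hq0 : 0 ≤ q) (hq1 : q < 1)
    {W : H →L[ℂ] H} (hW : ∀ n, W (e n) = (√(qNumber q (n + 1)) : ℂ) • e (n + 1)) :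
    QRelation q W := by
  have h : adjoint W ∘L W - (q : ℂ) • (W ∘L adjoint W) = ContinuousLinearMap.id ℂ H := by
    refine ContinuousLinearMap.ext_on (hilbertBasis_dense_span e) ?_
    rintro _ ⟨n, rfl⟩
    have hsq : ∀ n, (√(qNumber q n) : ℂ) * (√(qNumber q n) : ℂ) = (qNumber q n : ℂ) := fun n => by
      rw [← Complex.ofReal_mul, Real.mul_self_sqrt (qNumber_nonneg hq0 hq1 n)]
    have h1 : adjoint W (W (e n)) = (qNumber q (n + 1) : ℂ) • e n := by
      rw [hW, map_smul, adjoint_weightedShift_succ e hW, smul_smul, hsq]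
    have h2 : W (adjoint W (e n)) = (qNumber q n : ℂ) • e n := by
      cases n with
      | zero =>
        rw [adjoint_weightedShift_zero e hW, map_zero, qNumber_zero hq1]
        simp
      | succ n => rw [adjoint_weightedShift_succ e hW, map_smul, hW, smul_smul, hsq]
    change adjoint W (W (e n)) - (q : ℂ) • W (adjoint W (e n)) = e n
    rw [h1, h2, qNumber_succ' hq1]
    push_cast
    module
  exact fun x => DFunLike.congr_fun h x

theorem qNumber_succ_pos {q : ℝ} (hq0 : 0 ≤ q) (hq1 : q < 1) (n : ℕ) :
    0 < qNumber q (n + 1) := by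
  rw [qNumber_succ' hq1]
  have := mul_nonneg hq0 (qNumber_nonneg hq0 hq1 n)
  linarith

theorem IsQShift.exists_extends {q : ℝ} (hq0 : 0 ≤ q) (hq1 : q < 1) {S : H →ₗ.[ℂ] H}
    (hS : Dense (S.domain : Set H)) (hc : S.IsClosable) (h : IsQShift q S) :
    ∃ W, Extends W S ∧ QRelation q W ∧ IsIrreducible S := by
  obtain ⟨e, he⟩ := h
  obtain ⟨W, hW⟩ := exists_weightedShift e (w := fun n => √(qNumber q (n + 1)))
    (Real.sqrt_nonneg (1 - q)⁻¹) fun n => by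
      rw [abs_of_nonneg (Real.sqrt_nonneg _)]
      exact Real.sqrt_le_sqrt (qNumber_le hq0 hq1 _)
  have hWS : Extends W S := extends_of_hilbertBasis e hc fun n => by
    obtain ⟨hn, hn'⟩ := he n
    exact ⟨hn, hn'.trans (hW n).symm⟩
  exact ⟨W, hWS, qRelation_of_weightedShift e hq0 hq1 hW, isIrreducible_of_weightedShift e
    (fun n => (Real.sqrt_pos.2 (qNumber_succ_pos hq0 hq1 n)).ne') hW hS hWS⟩

end WeightedShift

/-! ### Irreducible normal operators and the case of trivial ker W*. -/

section Irreducible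

variable {H : Type u} [NormedAddCommGroup H] [InnerProductSpace ℂ H] [CompleteSpace H]

theorem Extends.domain_eq_top {S : H →ₗ.[ℂ] H} (hcl : S.IsClosed)
    (hS : Dense (S.domain : Set H)) {W : H →L[ℂ] H} (h : Extends W S) : S.domain = ⊤ :=
  Submodule.eq_top_iff'.2 fun x => LinearPMap.mem_domain_of_mem_graph <|
    mem_graph_of_dense hcl hS (fun y hy => by
      have := S.mem_graph ⟨y, hy⟩
      rwa [h ⟨y, hy⟩] at this) x

/-- A closed subspace invariant for an irreducible bounded everywhere defined operator and for its
adjoint is trivial. -/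
theorem IsIrreducible.eq_bot_or_eq_top {S : H →ₗ.[ℂ] H} (hirr : IsIrreducible S)
    (htop : S.domain = ⊤) {W : H →L[ℂ] H} (h : Extends W S) {L : Submodule ℂ H}
    (hL : IsClosed (L : Set H)) (h1 : ∀ x ∈ L, W x ∈ L) (h2 : ∀ x ∈ L, adjoint W x ∈ L) :
    L = ⊥ ∨ L = ⊤ := by
  refine hirr ⟨L, hL⟩ ⟨fun x hx => ?_, fun x hx => ?_, fun x _ => ?_⟩
  · rw [h]
    exact h1 _ hx
  · rw [h]
    refine (Submodule.mem_orthogonal _ _).2 fun y hy => ?_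
    rw [← ContinuousLinearMap.adjoint_inner_left]
    exact (Submodule.mem_orthogonal _ _).1 hx _ (h2 y hy)
  · rw [htop]
    trivial

theorem cfc_ne_zero_of_mem_spectrum {A : Type*} [CStarAlgebra A] {a : A} [IsStarNormal a]
    {f : ℂ → ℂ} (hf : Continuous f) {z : ℂ} (hz : z ∈ spectrum ℂ a) (hfz : f z ≠ 0) :
    cfc f a ≠ 0 := by
  intro h0
  have hmem : f z ∈ spectrum ℂ (cfc f a) := by
    rw [cfc_map_spectrum (R := ℂ) f a (by assumption) hf.continuousOn]
    exact ⟨z, hz, rfl⟩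
  rw [h0] at hmem
  have : Nontrivial A := by
    by_contra hA
    rw [not_nontrivial_iff_subsingleton] at hA
    simp at hz
  rw [spectrum.zero_eq] at hmem
  exact hfz hmem

/-- A normal operator without nontrivial closed subspaces invariant for it and its adjoint is
scalar. -/
theorem exists_eq_algebraMap_of_isStarNormal [Nontrivial H] {W : H →L[ℂ] H} (hW : IsStarNormal W)
    (hirr : ∀ L : Submodule ℂ H, IsClosed (L : Set H) → (∀ x ∈ L, W x ∈ L) →
      (∀ x ∈ L, adjoint W x ∈ L) → L = ⊥ ∨ L = ⊤) : ∃ c : ℂ, W = algebraMap ℂ (H →L[ℂ] H) c := by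
  obtain ⟨p, hp⟩ := spectrum.nonempty W
  have hsub : ∀ r ∈ spectrum ℂ W, r = p := by
    intro r hr
    by_contra hne
    -- Tent functions of radius d around two distinct spectral points have product zero. The kernel
    -- of f(W) is invariant under W and W*; it contains the nonzero range of g(W) and is not
    -- everything.
    set d := dist r p / 2
    have hd : 0 < d := half_pos (dist_pos.2 hne)
    let f : ℂ → ℂ := fun z => ((max 0 (d - dist z p) : ℝ) : ℂ)
    let g : ℂ → ℂ := fun z => ((max 0 (d - dist z r) : ℝ) : ℂ)
    have hf : Continuous f := by fun_prop
    have hg : Continuous g := by fun_prop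
    have hf0 : cfc f W ≠ 0 := cfc_ne_zero_of_mem_spectrum hf hp (by simp [f, hd])
    have hg0 : cfc g W ≠ 0 := cfc_ne_zero_of_mem_spectrum hg hr (by simp [g, hd])
    have hfg : cfc f W * cfc g W = 0 := by
      rw [← cfc_mul f g W hf.continuousOn hg.continuousOn, ← cfc_zero ℂ W]
      congr 1
      funext z
      have htri : dist r p ≤ dist z r + dist z p := dist_triangle_left r p z
      have h2d : dist r p = 2 * d := by ring
      simp only [f, g, Pi.zero_apply, ← Complex.ofReal_mul, Complex.ofReal_eq_zero, mul_eq_zero,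
        max_eq_left_iff]
      by_contra! hcon
      linarith [hcon.1, hcon.2]
    have hc1 : Commute (cfc f W) W := (Commute.refl W).cfc (star_comm_self' W) f
    have hc2 : Commute (cfc f W) (star W) := Commute.cfc (star_comm_self' W).symm (Commute.refl _) f
    have hcl : IsClosed ((LinearMap.ker (cfc f W).toLinearMap : Submodule ℂ H) : Set H) :=
      (cfc f W).isClosed_ker
    have hinv1 : ∀ x ∈ LinearMap.ker (cfc f W).toLinearMap,
        W x ∈ LinearMap.ker (cfc f W).toLinearMap := fun x hx => by
      have h1 : cfc f W (W x) = W (cfc f W x) := DFunLike.congr_fun hc1.eq x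
      have h2 : cfc f W x = 0 := hx
      exact h1.trans (by rw [h2, map_zero])
    have hinv2 : ∀ x ∈ LinearMap.ker (cfc f W).toLinearMap,
        adjoint W x ∈ LinearMap.ker (cfc f W).toLinearMap := fun x hx => by
      have h1 : cfc f W (adjoint W x) = adjoint W (cfc f W x) := DFunLike.congr_fun hc2.eq x
      have h2 : cfc f W x = 0 := hx
      exact h1.trans (by rw [h2, map_zero])
    rcases hirr _ hcl hinv1 hinv2 with h | h
    · refine hg0 (ContinuousLinearMap.ext fun x => ?_)
      have hx : cfc g W x ∈ LinearMap.ker (cfc f W).toLinearMap := DFunLike.congr_fun hfg x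
      rw [h] at hx
      exact hx
    · refine hf0 (ContinuousLinearMap.ext fun x => ?_)
      have hx : x ∈ LinearMap.ker (cfc f W).toLinearMap := h ▸ Submodule.mem_top
      exact hx
  refine ⟨p, ?_⟩
  conv_lhs => rw [← cfc_id' ℂ W]
  rw [← cfc_const p W]
  exact cfc_congr hsub

theorem rank_le_one_of_isStarNormal [Nontrivial H] {W : H →L[ℂ] H} (hW : IsStarNormal W)
    (hirr : ∀ L : Submodule ℂ H, IsClosed (L : Set H) → (∀ x ∈ L, W x ∈ L) →
      (∀ x ∈ L, adjoint W x ∈ L) → L = ⊥ ∨ L = ⊤) : Module.rank ℂ H ≤ 1 := by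
  obtain ⟨c, hc⟩ := exists_eq_algebraMap_of_isStarNormal hW hirr
  obtain ⟨v, hv⟩ := exists_ne (0 : H)
  have h1 : ∀ x, W x = c • x := fun x => by
    rw [hc, Algebra.algebraMap_eq_smul_one]
    rfl
  have h2 : ∀ x, adjoint W x = star c • x := fun x => by
    have : star W = star c • (1 : H →L[ℂ] H) := by
      rw [hc, Algebra.algebraMap_eq_smul_one, star_smul, star_one]
    rw [← ContinuousLinearMap.star_eq_adjoint, this]
    rfl
  rcases hirr (ℂ ∙ v) (Submodule.closed_of_finiteDimensional _)
    (fun x hx => by rw [h1]; exact Submodule.smul_mem _ _ hx)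
    (fun x hx => by rw [h2]; exact Submodule.smul_mem _ _ hx) with h | h
  · exact absurd (Submodule.span_singleton_eq_bot.1 h) hv
  · have := rank_span_le (R := ℂ) ({v} : Set H)
    rwa [h, rank_top, Cardinal.mk_singleton] at this

/-- The norm identity gives ‖x‖ ≤ ‖Wx‖, so the range is closed; its orthogonal complement is ker W*.
-/
theorem QRelation.surjective_of_ker_adjoint {q : ℝ} (hq0 : 0 ≤ q) {W : H →L[ℂ] H}
    (h : QRelation q W) (hker : ∀ x, adjoint W x = 0 → x = 0) : Function.Surjective W := by
  have hanti : AntilipschitzWith 1 W := W.antilipschitz_of_bound fun x => by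
    rw [NNReal.coe_one, one_mul]
    refine le_of_sq_le_sq ?_ (norm_nonneg _)
    rw [h.norm_sq]
    have : 0 ≤ q * ‖adjoint W x‖ ^ 2 := by positivity
    linarith
  have hcl : IsClosed (W.range : Set H) := hanti.isClosed_range W.uniformContinuous
  have hbot : W.rangeᗮ = ⊥ := by
    rw [W.orthogonal_range]
    exact (Submodule.eq_bot_iff _).2 hker
  have : W.range = ⊤ := by
    rw [← hcl.submodule_topologicalClosure_eq]
    exact (Submodule.topologicalClosure_eq_top_iff).2 hbot
  exact LinearMap.range_eq_top.1 this

/-- A lower bound for a surjective operator is a lower bound for its adjoint. -/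
theorem adjoint_lower_bound {W : H →L[ℂ] H} (hsurj : Function.Surjective W) {a : ℝ} (ha : 0 ≤ a)
    (h : ∀ x, a * ‖x‖ ^ 2 ≤ ‖W x‖ ^ 2) (y : H) : a * ‖y‖ ^ 2 ≤ ‖adjoint W y‖ ^ 2 := by
  obtain ⟨x, rfl⟩ := hsurj y
  have h1 : ‖W x‖ ^ 2 ≤ ‖adjoint W (W x)‖ * ‖x‖ := by
    have := norm_inner_le_norm (𝕜 := ℂ) (adjoint W (W x)) x
    rw [ContinuousLinearMap.adjoint_inner_left, inner_self_eq_ofReal, Complex.norm_real,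
      Real.norm_of_nonneg (by positivity)] at this
    exact this
  rcases (norm_nonneg (W x)).eq_or_lt with h0 | h0
  · rw [← h0]
    simp
  -- Multiplying by ‖Wx‖² allows both the Cauchy–Schwarz bound and the assumed lower bound to be
  -- used; the factor cancels since Wx ≠ 0.
  refine le_of_mul_le_mul_right ?_ (pow_pos h0 2)
  calc a * ‖W x‖ ^ 2 * ‖W x‖ ^ 2 = a * (‖W x‖ ^ 2) ^ 2 := by ring
    _ ≤ a * (‖adjoint W (W x)‖ * ‖x‖) ^ 2 := by gcongr
    _ = ‖adjoint W (W x)‖ ^ 2 * (a * ‖x‖ ^ 2) := by ring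
    _ ≤ ‖adjoint W (W x)‖ ^ 2 * ‖W x‖ ^ 2 := by
      gcongr
      exact h x

/-- Surjectivity passes the bound [n]_q from W to W*, and the norm identity returns 1 + q[n]_q =
[n+1]_q for W. -/
theorem QRelation.qNumber_mul_norm_sq_le {q : ℝ} (hq0 : 0 ≤ q) (hq1 : q < 1) {W : H →L[ℂ] H}
    (h : QRelation q W) (hsurj : Function.Surjective W) (n : ℕ) (x : H) :
    qNumber q n * ‖x‖ ^ 2 ≤ ‖W x‖ ^ 2 := by
  induction n generalizing x with
  | zero => rw [qNumber_zero hq1]; simp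
  | succ n ih =>
    have := adjoint_lower_bound hsurj (qNumber_nonneg hq0 hq1 n) ih x
    rw [qNumber_succ' hq1, h.norm_sq]
    nlinarith [mul_le_mul_of_nonneg_left this hq0]

theorem tendsto_qNumber {q : ℝ} (hq0 : 0 ≤ q) (hq1 : q < 1) :
    Filter.Tendsto (qNumber q) Filter.atTop (nhds (1 - q)⁻¹) := by
  have h := ((tendsto_pow_atTop_nhds_zero_of_lt_one hq0 hq1).const_sub 1).div_const (1 - q)
  rw [sub_zero, one_div] at h
  refine h.congr fun n => ?_
  rw [qNumber, if_neg hq1.ne]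

/-- The lower bounds increase to 1/(1 - q) = ‖W‖². Hence ‖Wx‖² ≤ ‖W‖²‖x‖² ≤ ‖W*x‖², while the
reverse inequality always holds. -/
theorem QRelation.isStarNormal_of_surjective {q : ℝ} (hq0 : 0 ≤ q) (hq1 : q < 1)
    {W : H →L[ℂ] H} (h : QRelation q W) (hsurj : Function.Surjective W) : IsStarNormal W := by
  cases subsingleton_or_nontrivial H
  · exact ⟨Subsingleton.elim _ _⟩
  refine ContinuousLinearMap.isStarNormal_iff_norm_eq_adjoint.2 fun x => ?_
  have hpos : 0 < (1 - q)⁻¹ := inv_pos.2 (by linarith)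
  have hle : ∀ x, (1 - q)⁻¹ * ‖x‖ ^ 2 ≤ ‖W x‖ ^ 2 := fun x =>
    le_of_tendsto ((tendsto_qNumber hq0 hq1).mul_const _)
      (Filter.Eventually.of_forall fun n => h.qNumber_mul_norm_sq_le hq0 hq1 hsurj n x)
  have h1 := adjoint_lower_bound hsurj hpos.le hle x
  refine le_antisymm (le_of_sq_le_sq ?_ (norm_nonneg _)) (h.norm_adjoint_le hq0 hq1 x)
  refine le_trans ?_ h1
  rw [← h.norm_sq_eq hq0 hq1, ← mul_pow]
  gcongr
  exact W.le_opNorm x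

end Irreducible

/-! ### The orthonormal ladder over a vector of ker W*. -/

noncomputable section LadderVectors

variable {H : Type u} [NormedAddCommGroup H] [InnerProductSpace ℂ H] [CompleteSpace H]

/-- The normalized vectors `W^n v`, up to the scalar `([n]_q!)^{-1/2}`. -/
def ladder (q : ℝ) (W : H →L[ℂ] H) (v : H) : ℕ → H
  | 0 => v
  | n + 1 => ((√(qNumber q (n + 1)))⁻¹ : ℂ) • W (ladder q W v n)

variable {q : ℝ} {W : H →L[ℂ] H} {v : H}

theorem apply_ladder (hq0 : 0 ≤ q) (hq1 : q < 1) (n : ℕ) :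
    W (ladder q W v n) = (√(qNumber q (n + 1)) : ℂ) • ladder q W v (n + 1) := by
  have : (√(qNumber q (n + 1)) : ℂ) ≠ 0 :=
    Complex.ofReal_ne_zero.2 (Real.sqrt_pos.2 (qNumber_succ_pos hq0 hq1 n)).ne'
  rw [ladder, smul_inv_smul₀ this]

theorem QRelation.adjoint_apply_ladder (h : QRelation q W) (hq1 : q < 1)
    (hv : adjoint W v = 0) (n : ℕ) :
    adjoint W (W (ladder q W v n)) = (qNumber q (n + 1) : ℂ) • ladder q W v n := by
  have hrel : ∀ x, adjoint W (W x) = x + (q : ℂ) • W (adjoint W x) := fun x =>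
    sub_eq_iff_eq_add.1 (h x)
  induction n with
  | zero =>
    rw [hrel, ladder, hv, qNumber_succ hq1, qNumber_zero hq1]
    simp
  | succ n ih =>
    rw [hrel]
    have h1 : W (adjoint W (ladder q W v (n + 1))) =
        (qNumber q (n + 1) : ℂ) • ladder q W v (n + 1) := by
      rw [ladder, map_smul, map_smul, ih, map_smul, smul_comm]
    rw [h1, qNumber_succ' hq1 (n + 1)]
    push_cast
    module

theorem QRelation.adjoint_ladder_succ (h : QRelation q W) (hq0 : 0 ≤ q) (hq1 : q < 1)
    (hv : adjoint W v = 0) (n : ℕ) :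
    adjoint W (ladder q W v (n + 1)) = (√(qNumber q (n + 1)) : ℂ) • ladder q W v n := by
  have hpos := qNumber_succ_pos hq0 hq1 n
  have h0 : (√(qNumber q (n + 1)) : ℂ) ≠ 0 :=
    Complex.ofReal_ne_zero.2 (Real.sqrt_pos.2 hpos).ne'
  have hsq : (qNumber q (n + 1) : ℂ) = √(qNumber q (n + 1)) * √(qNumber q (n + 1)) := by
    rw [← Complex.ofReal_mul, Real.mul_self_sqrt hpos.le]
  rw [ladder, map_smul, h.adjoint_apply_ladder hq1 hv, hsq, smul_smul, inv_mul_cancel_left₀ h0]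

/-- Moving one `W` across the inner product lowers both indices, until index 0 on the left is
annihilated by W*. -/
theorem QRelation.inner_ladder (h : QRelation q W) (hq0 : 0 ≤ q) (hq1 : q < 1)
    (hv : adjoint W v = 0) (hv1 : ‖v‖ = 1) (m n : ℕ) (hmn : m ≤ n) :
    ⟪ladder q W v m, ladder q W v n⟫_ℂ = if m = n then 1 else 0 := by
  induction n generalizing m with
  | zero =>
    obtain rfl : m = 0 := by omega
    rw [ladder, inner_self_eq_ofReal, hv1]
    simp
  | succ n ih =>
    have h0 : (√(qNumber q (n + 1)) : ℂ) ≠ 0 :=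
      Complex.ofReal_ne_zero.2 (Real.sqrt_pos.2 (qNumber_succ_pos hq0 hq1 n)).ne'
    have hstep : ⟪ladder q W v m, ladder q W v (n + 1)⟫_ℂ =
        (√(qNumber q (n + 1)) : ℂ)⁻¹ * ⟪adjoint W (ladder q W v m), ladder q W v n⟫_ℂ := by
      rw [ContinuousLinearMap.adjoint_inner_left, ← inner_smul_right]
      rfl
    cases m with
    | zero =>
      rw [hstep, ladder, hv]
      simp
    | succ m =>
      rw [hstep, h.adjoint_ladder_succ hq0 hq1 hv, inner_smul_left, Complex.conj_ofReal,
        ih m (by omega)]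
      rcases eq_or_ne m n with rfl | hne
      · simp [h0]
      · simp [hne]

theorem QRelation.orthonormal_ladder (h : QRelation q W) (hq0 : 0 ≤ q) (hq1 : q < 1)
    (hv : adjoint W v = 0) (hv1 : ‖v‖ = 1) : Orthonormal ℂ (ladder q W v) := by
  refine orthonormal_iff_ite.2 fun m n => ?_
  rcases le_total m n with hmn | hmn
  · exact h.inner_ladder hq0 hq1 hv hv1 m n hmn
  · rw [← inner_conj_symm, h.inner_ladder hq0 hq1 hv hv1 n m hmn]
    by_cases hnm : n = m
    · simp [hnm]
    · simp [hnm, Ne.symm hnm]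

theorem mem_closure_span_of_forall {e : ℕ → H} {T : H →L[ℂ] H}
    (hT : ∀ n, T (e n) ∈ (Submodule.span ℂ (Set.range e)).topologicalClosure) {x : H}
    (hx : x ∈ (Submodule.span ℂ (Set.range e)).topologicalClosure) :
    T x ∈ (Submodule.span ℂ (Set.range e)).topologicalClosure := by
  set L := (Submodule.span ℂ (Set.range e)).topologicalClosure
  have hcl : IsClosed ((L.comap T.toLinearMap : Submodule ℂ H) : Set H) :=
    (Submodule.isClosed_topologicalClosure _).preimage T.continuous
  refine Submodule.topologicalClosure_minimal _ (Submodule.span_le.2 ?_) hcl hx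
  rintro _ ⟨n, rfl⟩
  exact hT n

theorem QRelation.isQShift [Nontrivial H] (h : QRelation q W) (hq0 : 0 ≤ q) (hq1 : q < 1)
    {S : H →ₗ.[ℂ] H} (hS : Dense (S.domain : Set H)) (hcl : S.IsClosed) (hWS : Extends W S)
    (hirr : IsIrreducible S) (hrank : 1 < Module.rank ℂ H) : IsQShift q S := by
  have htop := hWS.domain_eq_top hcl hS
  have hirr' : ∀ L : Submodule ℂ H, IsClosed (L : Set H) → (∀ x ∈ L, W x ∈ L) →
      (∀ x ∈ L, adjoint W x ∈ L) → L = ⊥ ∨ L = ⊤ :=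
    fun L hL h1 h2 => hirr.eq_bot_or_eq_top htop hWS hL h1 h2
  -- The only use of dim H ≥ 2: a scalar of modulus (1 - q)^(-1/2) on a line satisfies the relation
  -- with ker W* = 0.
  obtain ⟨u, hu, hu0⟩ : ∃ u, adjoint W u = 0 ∧ u ≠ 0 := by
    by_contra! hker
    have hsurj := h.surjective_of_ker_adjoint hq0 hker
    exact absurd (rank_le_one_of_isStarNormal (h.isStarNormal_of_surjective hq0 hq1 hsurj) hirr')
      hrank.not_ge
  set v : H := ((‖u‖⁻¹ : ℝ) : ℂ) • u with hvdef
  have hv : adjoint W v = 0 := by rw [hvdef, map_smul, hu, smul_zero]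
  have hv1 : ‖v‖ = 1 := by
    rw [hvdef, norm_smul, Complex.norm_real, norm_inv, norm_norm,
      inv_mul_cancel₀ (norm_ne_zero_iff.2 hu0)]
  have hmem : ∀ n, ladder q W v n ∈
      (Submodule.span ℂ (Set.range (ladder q W v))).topologicalClosure := fun n =>
    Submodule.le_topologicalClosure _ (Submodule.subset_span ⟨n, rfl⟩)
  have htotal : (Submodule.span ℂ (Set.range (ladder q W v))).topologicalClosure = ⊤ := by
    refine (hirr' _ (Submodule.isClosed_topologicalClosure _)
      (fun x hx => mem_closure_span_of_forall (fun n => ?_) hx)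
      (fun x hx => mem_closure_span_of_forall (fun n => ?_) hx)).resolve_left fun hbot => ?_
    · rw [apply_ladder hq0 hq1]
      exact Submodule.smul_mem _ _ (hmem _)
    · cases n with
      | zero =>
        rw [ladder, hv]
        exact Submodule.zero_mem _
      | succ n =>
        rw [h.adjoint_ladder_succ hq0 hq1 hv]
        exact Submodule.smul_mem _ _ (hmem _)
    · have h0 := hmem 0
      rw [hbot, Submodule.mem_bot, ladder] at h0
      rw [h0, norm_zero] at hv1
      exact zero_ne_one hv1
  refine ⟨HilbertBasis.mk (h.orthonormal_ladder hq0 hq1 hv hv1) htotal.ge, fun n => ?_⟩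
  rw [HilbertBasis.coe_mk]
  refine ⟨htop ▸ Submodule.mem_top, ?_⟩
  rw [hWS]
  exact apply_ladder hq0 hq1 n

end LadderVectors

end QOscillator

/-! ### The equivalences. -/

theorem mainTheorem2 {H : Type u} [NormedAddCommGroup H] [InnerProductSpace ℂ H]
    [CompleteSpace H] [Nontrivial H] (q : ℝ) (hq0 : 0 ≤ q) (hq1 : q < 1)
    (S : H →ₗ.[ℂ] H) (hdense : Dense (S.domain : Set H)) (hclosable : S.IsClosable) :
    -- all six conditions are equivalent if `S` is closed and `dim H ≥ 2`
    (S.IsClosed → 1 < Module.rank ℂ H →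
      List.TFAE [
        QOscillator.IsQShift q S,
        QOscillator.IsIrreducible S ∧ (∃ D, QOscillator.SatisfiesOn q S D) ∧
          QOscillator.IsBoundedOp S ∧ QOscillator.opNorm S = (1 - q) ^ (-(1 / 2) : ℝ),
        QOscillator.IsIrreducible S ∧ (∃ D, QOscillator.SatisfiesOn q S D) ∧
          QOscillator.IsBoundedOp S ∧ QOscillator.opNorm S ≤ (1 - q) ^ (-(1 / 2) : ℝ),
        QOscillator.IsIrreducible S ∧ (∃ D, QOscillator.SatisfiesOn q S D) ∧
          QOscillator.IsBoundedOp S,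
        QOscillator.IsIrreducible S ∧ (∃ D, QOscillator.SatisfiesOn q S D) ∧
          QOscillator.IsSubnormal S,
        QOscillator.IsIrreducible S ∧ (∃ D, QOscillator.SatisfiesOn q S D) ∧
          QOscillator.IsHyponormal S]) ∧
    -- without these two assumptions the first condition still implies the second
    (QOscillator.IsQShift q S →
      QOscillator.IsIrreducible S ∧ (∃ D, QOscillator.SatisfiesOn q S D) ∧
        QOscillator.IsBoundedOp S ∧ QOscillator.opNorm S = (1 - q) ^ (-(1 / 2) : ℝ)) ∧
    -- and the last five are equivalent
    List.TFAE [
      QOscillator.IsIrreducible S ∧ (∃ D, QOscillator.SatisfiesOn q S D) ∧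
        QOscillator.IsBoundedOp S ∧ QOscillator.opNorm S = (1 - q) ^ (-(1 / 2) : ℝ),
      QOscillator.IsIrreducible S ∧ (∃ D, QOscillator.SatisfiesOn q S D) ∧
        QOscillator.IsBoundedOp S ∧ QOscillator.opNorm S ≤ (1 - q) ^ (-(1 / 2) : ℝ),
      QOscillator.IsIrreducible S ∧ (∃ D, QOscillator.SatisfiesOn q S D) ∧
        QOscillator.IsBoundedOp S,
      QOscillator.IsIrreducible S ∧ (∃ D, QOscillator.SatisfiesOn q S D) ∧
        QOscillator.IsSubnormal S,
      QOscillator.IsIrreducible S ∧ (∃ D, QOscillator.SatisfiesOn q S D) ∧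
        QOscillator.IsHyponormal S] := by
  have hyp_bdd : QOscillator.IsHyponormal S → (∃ D, QOscillator.SatisfiesOn q S D) →
      QOscillator.IsBoundedOp S :=
    fun h ⟨_, hD⟩ => h.isBoundedOp hq0 hq1 hD
  -- Irreducibility plays no role here: the relation and boundedness alone give the exact norm and
  -- subnormality, which serve both cycles.
  have bdd_norm : (∃ D, QOscillator.SatisfiesOn q S D) → QOscillator.IsBoundedOp S →
      QOscillator.opNorm S = (1 - q) ^ (-(1 / 2) : ℝ) ∧ QOscillator.IsSubnormal S := by
    intro hD hb
    obtain ⟨W, hWS⟩ := hb.exists_extends hdense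
    have hW := (hWS.exists_satisfiesOn_iff hclosable hdense q).1 hD
    exact ⟨(hWS.opNorm_eq hdense).trans (hW.norm_eq hq0 hq1),
      hW.isSubnormal hq0 hq1 hdense hWS⟩
  have shift_imp : QOscillator.IsQShift q S →
      QOscillator.IsIrreducible S ∧ (∃ D, QOscillator.SatisfiesOn q S D) ∧
        QOscillator.IsBoundedOp S ∧ QOscillator.opNorm S = (1 - q) ^ (-(1 / 2) : ℝ) := by
    intro h
    obtain ⟨W, hWS, hW, hirr⟩ := h.exists_extends hq0 hq1 hdense hclosable
    have hD := (hWS.exists_satisfiesOn_iff hclosable hdense q).2 hW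
    exact ⟨hirr, hD, hWS.isBoundedOp, (bdd_norm hD hWS.isBoundedOp).1⟩
  refine ⟨fun hcl hrank => ?_, shift_imp, ?_⟩
  · tfae_have 1 → 2 := shift_imp
    tfae_have 2 → 3 := fun ⟨h1, h2, h3, h4⟩ => ⟨h1, h2, h3, h4.le⟩
    tfae_have 3 → 4 := fun ⟨h1, h2, h3, _⟩ => ⟨h1, h2, h3⟩
    tfae_have 4 → 5 := fun ⟨h1, h2, h3⟩ => ⟨h1, h2, (bdd_norm h2 h3).2⟩
    tfae_have 5 → 6 := fun ⟨h1, h2, h3⟩ => ⟨h1, h2, h3.isHyponormal⟩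
    tfae_have 6 → 1 := fun ⟨h1, h2, h3⟩ => by
      obtain ⟨W, hWS⟩ := (hyp_bdd h3 h2).exists_extends hdense
      have hW := (hWS.exists_satisfiesOn_iff hclosable hdense q).1 h2
      exact hW.isQShift hq0 hq1 hdense hcl hWS h1 hrank
    tfae_finish
  · tfae_have 1 → 2 := fun ⟨h1, h2, h3, h4⟩ => ⟨h1, h2, h3, h4.le⟩
    tfae_have 2 → 3 := fun ⟨h1, h2, h3, _⟩ => ⟨h1, h2, h3⟩
    tfae_have 3 → 4 := fun ⟨h1, h2, h3⟩ => ⟨h1, h2, (bdd_norm h2 h3).2⟩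
    tfae_have 4 → 5 := fun ⟨h1, h2, h3⟩ => ⟨h1, h2, h3.isHyponormal⟩
    tfae_have 5 → 1 := fun ⟨h1, h2, h3⟩ =>
      ⟨h1, h2, hyp_bdd h3 h2, (bdd_norm h2 (hyp_bdd h3 h2)).1⟩
    tfae_finish
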